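/- Let $m\ge 0$ and let $L_1,\dots,L_m\in M_3(\mathbb{C})$ be arbitrary. For $L\in M_3(\mathbb{C})$ put $\mathcal{D}_L(X)=LXL^\dagger-\tfrac12(L^\dagger L X+XL^\dagger L)$, and let $\mathcal{D}=\sum_{j=1}^m\mathcal{D}_{L_j}$. A time-dependent Hamiltonian is a map $H:\mathbb{R}\to M_3(\mathbb{C})$ with $H(t)$ Hermitian for every $t$ and with locally integrable entries. For such $H$ let $\mathcal{L}_t=-i[H(t),\,\cdot\,]+\mathcal{D}$, and for $t\ge s$ let $$\mathcal{E}_{t,s}=\mathcal{T}\exp\Big(\int_s^t\mathcal{L}_\tau\,d\tau\Big)=\sum_{n\ge 0}\ \int_{t\ge\tau_1\ge\dots\ge\tau_n\ge s}\mathcal{L}_{\tau_1}\cdots\mathcal{L}_{\tau_n}\,d\tau_1\cdots d\tau_n$$ be its time-evolution map (the $n=0$ term being the identity). The family $\mathcal{L}_t$ is called exponentially contractive if there are constants $K,\gamma>0$ such that for all states $\rho,\sigma$ (positive semidefinite matrices of trace one) and all $t\ge s\ge 0$, $$\|\mathcal{E}_{t,s}(\rho-\sigma)\|_1\le K e^{-\gamma|t-s|}\,\|\rho-\sigma\|_1,$$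 where $\|\cdot\|_1$ is the trace norm (the sum of the singular values). The dissipator $\mathcal{D}$ is called Hamiltonian-independently contractive if $\mathcal{L}_t=-i[H(t),\,\cdot\,]+\mathcal{D}$ is exponentially contractive for every time-dependent Hamiltonian $H$ (where $K,\gamma$ may depend on $H$). Then: 1. (Sufficient condition.) If $\{L_j\}_j$ generates $M_3(\mathbb{C})$ as a complex algebra, then $\mathcal{D}$ is Hamiltonian-independently contractive. 2. (Necessary condition.) If $\mathcal{D}$ is Hamiltonian-independently contractive, then $\{L_j,L_j^\dagger\}_j$ generates $M_3(\mathbb{C})$ as a complex algebra. -/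

import Mathlib

open MeasureTheory
open scoped Matrix ComplexOrder

noncomputable section

section TimeOrderedExponential

variable {V : Type*} [NormedAddCommGroup V] [NormedSpace ℂ V]

/-- The terms of the Dyson series for the time-dependent generator `A`, applied to `v`, as functions
of the final time `t` (first real argument) and the initial time `s`: the `n`-th one is the integral
of `A (τ 1) (A (τ 2) (⋯ (A (τ n) v)))` over `t ≥ τ 1 ≥ ⋯ ≥ τ n ≥ s`, written as an iterated
integral. -/
def dysonTerm (A : ℝ → V →ₗ[ℂ] V) (v : V) : ℕ → ℝ → ℝ → V
  | 0, _, _ => v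
  | n + 1, t, s => ∫ τ in s..t, A τ (dysonTerm A v n τ s)

/-- The time-ordered exponential `𝒯 exp (∫ τ in s..t, A τ)` applied to `v`, i.e. the sum of the Dyson
series: the state at time `t` of the evolution generated by `A` that is in state `v` at time `s`. -/
def timeOrderedExp (A : ℝ → V →ₗ[ℂ] V) (t s : ℝ) (v : V) : V :=
  ∑' n, dysonTerm A v n t s

end TimeOrderedExponential

/-- The linear operators (super-operators) on the space of `d × d` complex matrices. -/
abbrev SuperOp (d : ℕ) : Type :=
  Matrix (Fin d) (Fin d) ℂ →ₗ[ℂ] Matrix (Fin d) (Fin d) ℂ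

/-- The super-operator `X ↦ -i [H, X]`. -/
def hamiltonianPart {d : ℕ} (H : Matrix (Fin d) (Fin d) ℂ) : SuperOp d :=
  -Complex.I • (LinearMap.mulLeft ℂ H - LinearMap.mulRight ℂ H)

/-- The dissipator of one jump operator, `X ↦ L X L† - (L† L X + X L† L) / 2`. -/
def jumpDissipator {d : ℕ} (L : Matrix (Fin d) (Fin d) ℂ) : SuperOp d :=
  LinearMap.mulLeft ℂ L ∘ₗ LinearMap.mulRight ℂ Lᴴ
    - (1 / 2 : ℂ) • (LinearMap.mulLeft ℂ (Lᴴ * L) + LinearMap.mulRight ℂ (Lᴴ * L))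

/-- The dissipator `∑ j, D_{L j}` of a finite family of jump operators. -/
def dissipator {d m : ℕ} (L : Fin m → Matrix (Fin d) (Fin d) ℂ) : SuperOp d :=
  ∑ j, jumpDissipator (L j)

/-- Quantum states: positive semidefinite matrices of trace one. -/
def IsState {d : ℕ} (ρ : Matrix (Fin d) (Fin d) ℂ) : Prop :=
  ρ.PosSemidef ∧ ρ.trace = 1

/-- The trace norm: the sum of the singular values of `X`, i.e. of the square roots of the
eigenvalues of `X† X`. -/
def traceNorm {d : ℕ} (X : Matrix (Fin d) (Fin d) ℂ) : ℝ :=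
  ∑ i, √((Matrix.isHermitian_conjTranspose_mul_self X).eigenvalues i)

section Evolution

open scoped Matrix.Norms.Frobenius

/-- The time-evolution map `𝓔_{t,s}` of the time-dependent generator `A`.  The matrix space carries
the Frobenius norm; it is finite-dimensional, so the choice of the norm affects neither the values of
the integrals nor the sum of the series. -/
def evolution {d : ℕ} (A : ℝ → SuperOp d) (t s : ℝ) (X : Matrix (Fin d) (Fin d) ℂ) :
    Matrix (Fin d) (Fin d) ℂ :=
  timeOrderedExp A t s X

end Evolution

/-- A time-dependent generator is exponentially contractive if the trace distance of any two states
evolving under it decays exponentially, uniformly in the states and in the times. -/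
def ExponentiallyContractive {d : ℕ} (A : ℝ → SuperOp d) : Prop :=
  ∃ K γ : ℝ, 0 < K ∧ 0 < γ ∧
    ∀ ρ σ : Matrix (Fin d) (Fin d) ℂ, IsState ρ → IsState σ → ∀ s t : ℝ, 0 ≤ s → s ≤ t →
      traceNorm (evolution A t s (ρ - σ)) ≤ K * Real.exp (-γ * |t - s|) * traceNorm (ρ - σ)

/-- A time-dependent Hamiltonian: Hermitian at all times, with locally integrable entries. -/
structure IsHamiltonian {d : ℕ} (H : ℝ → Matrix (Fin d) (Fin d) ℂ) : Prop where
  isHermitian : ∀ t, (H t).IsHermitian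
  locallyIntegrable : ∀ i j, LocallyIntegrable (fun t => H t i j) volume

/-- `D` is Hamiltonian-independently contractive if `-i [H(t), ·] + D` is exponentially contractive
for every time-dependent Hamiltonian `H`. -/
def HamiltonianIndependentlyContractive {d : ℕ} (D : SuperOp d) : Prop :=
  ∀ H : ℝ → Matrix (Fin d) (Fin d) ℂ, IsHamiltonian H →
    ExponentiallyContractive (fun t => hamiltonianPart (H t) + D)

end

/-! ### Convergence of the Dyson series and the integral equation -/

section DysonSeries

open Set Filter Topology

/-! Sufficiency. On Hermitian matrices the trace norm is the maximum of `Re tr (S X)` over Hermitian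
contractions `S`. A maximizer acts as `1` and `-1` on the positive and negative parts of `X = P -
Q`, so it commutes with `X` and the Hamiltonian contributes nothing to the derivative. The
dissipator contributes minus a sum of terms `tr ((1 - S) L P L†) + tr ((1 + S) L Q L†)`, all
nonnegative (`trace_mul_dissipator`). If all vanish, every `L j` maps the range of `P` into `ker (1
- S)` and that of `Q` into `ker (1 + S)`. In dimension 3 one of these eigenspaces is at most a line,
hence equal to the nonzero range inside it: a proper invariant subspace, which a generating family
excludes (`re_trace_mul_dissipator_neg`). Compactness makes the decrease uniform
(`exists_uniform_rate`), with a rate that does not see `H`, and a Grönwall argument valid for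
locally integrable generators (`LipschitzWith.le_exp_mul_of_supporting`) integrates it.

Necessity. A proper self-adjoint algebra has a non-scalar `F` in its commutant
(`exists_commute_ne_smul_one`). Under zero Hamiltonian `tr (F ρ)` is conserved, yet it separates two
states, so their difference cannot decay. -/

theorem AbsolutelyContinuousOnInterval.pow {f : ℝ → ℝ} {a b : ℝ}
    (hf : AbsolutelyContinuousOnInterval f a b) (n : ℕ) :
    AbsolutelyContinuousOnInterval (fun x => f x ^ (n + 1)) a b := by
  induction n with
  | zero => simpa using hf
  | succ n ih => simpa [pow_succ] using ih.fun_mul hf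

theorem MeasureTheory.LocallyIntegrable.intervalIntegrable_real {F : Type*} [NormedAddCommGroup F]
    {f : ℝ → F} (hf : LocallyIntegrable f volume) (a b : ℝ) : IntervalIntegrable f volume a b :=
  intervalIntegrable_iff.mpr
    ((hf.integrableOn_isCompact isCompact_uIcc).mono_set uIoc_subset_uIcc)

theorem MeasureTheory.LocallyIntegrable.norm_real {F : Type*} [NormedAddCommGroup F]
    {f : ℝ → F} (hf : LocallyIntegrable f volume) : LocallyIntegrable (fun x => ‖f x‖) volume :=
  fun x => (hf x).norm

/-- As `a` is only locally integrable, the chain rule holds almost everywhere; absolute continuity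
of powers of the primitive still gives the fundamental theorem of calculus. This produces the
factorials in the Dyson bounds. -/
theorem integral_mul_primitive_pow {a : ℝ → ℝ} {s t : ℝ} (ha : LocallyIntegrable a volume) (n : ℕ) :
    ∫ τ in s..t, a τ * (∫ x in s..τ, a x) ^ n = (∫ x in s..t, a x) ^ (n + 1) / (n + 1) := by
  have hint : ∀ x y, IntervalIntegrable a volume x y := ha.intervalIntegrable_real
  have hac : AbsolutelyContinuousOnInterval (fun τ => ∫ x in s..τ, a x) s t :=
    (hint s t).absolutelyContinuousOnInterval_intervalIntegral (by simp)
  have hftc := (hac.pow n).integral_deriv_eq_sub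
  have hder : ∀ᵐ τ, deriv (fun τ => (∫ x in s..τ, a x) ^ (n + 1)) τ
      = (n + 1) * (a τ * (∫ x in s..τ, a x) ^ n) := by
    filter_upwards [LocallyIntegrable.ae_hasDerivAt_integral ha] with τ hτ
    rw [((hτ s).fun_pow (n + 1)).deriv]
    push_cast
    ring
  rw [intervalIntegral.integral_congr_ae (hder.mono fun _ h _ => h),
    intervalIntegral.integral_const_mul] at hftc
  simp only [intervalIntegral.integral_same, ne_eq, Nat.add_eq_zero_iff, one_ne_zero, and_false,
    not_false_eq_true, zero_pow, sub_zero] at hftc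
  rw [eq_div_iff (by positivity), ← hftc]
  ring

variable {E : Type*} [NormedAddCommGroup E] [NormedSpace ℂ E]

theorem ContinuousOn.intervalIntegrable_clm_apply {B : ℝ → E →L[ℂ] E} {u : ℝ → E} {s t : ℝ}
    (hB : LocallyIntegrable B volume) (hu : ContinuousOn u (uIcc s t)) :
    IntervalIntegrable (fun τ => B τ (u τ)) volume s t := by
  have hBi : IntervalIntegrable B volume s t := hB.intervalIntegrable_real s t
  obtain ⟨C, hC⟩ := isCompact_uIcc.exists_bound_of_continuousOn hu
  have hmu : AEStronglyMeasurable u (volume.restrict (uIoc s t)) :=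
    (hu.aestronglyMeasurable measurableSet_uIcc).mono_set uIoc_subset_uIcc
  have hmB := hBi.aestronglyMeasurable_restrict_uIoc
  refine (hBi.norm.mul_const C).mono_fun
    (isBoundedBilinearMap_apply.continuous.comp_aestronglyMeasurable (hmB.prodMk hmu)) ?_
  filter_upwards [ae_restrict_mem measurableSet_uIoc] with τ hτ
  calc ‖B τ (u τ)‖ ≤ ‖B τ‖ * ‖u τ‖ := (B τ).le_opNorm _
    _ ≤ ‖B τ‖ * C := by gcongr; exact hC τ (uIoc_subset_uIcc hτ)
    _ ≤ ‖‖B τ‖ * C‖ := le_abs_self _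

theorem continuous_dysonTerm {B : ℝ → E →L[ℂ] E} (hB : LocallyIntegrable B volume) (v : E)
    (s : ℝ) (n : ℕ) :
    Continuous fun t => dysonTerm (fun τ => (B τ : E →ₗ[ℂ] E)) v n t s := by
  cases n with
  | zero => exact continuous_const
  | succ n =>
    exact intervalIntegral.continuous_primitive
      (fun a b => ((continuous_dysonTerm hB v s n).continuousOn).intervalIntegrable_clm_apply hB) s

theorem norm_dysonTerm_le {B : ℝ → E →L[ℂ] E} (hB : LocallyIntegrable B volume) (v : E)
    (s : ℝ) (n : ℕ) {t : ℝ} (hst : s ≤ t) :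
    ‖dysonTerm (fun τ => (B τ : E →ₗ[ℂ] E)) v n t s‖
      ≤ (∫ x in s..t, ‖B x‖) ^ n / n.factorial * ‖v‖ := by
  induction n generalizing t with
  | zero => simp [dysonTerm]
  | succ n ih =>
    have hBn : LocallyIntegrable (fun x => ‖B x‖) volume := hB.norm_real
    have hcont : Continuous fun τ => (∫ x in s..τ, ‖B x‖) :=
      intervalIntegral.continuous_primitive hBn.intervalIntegrable_real s
    calc ‖dysonTerm (fun τ => (B τ : E →ₗ[ℂ] E)) v (n + 1) t s‖
        ≤ ∫ τ in s..t, ‖B τ‖ * (∫ x in s..τ, ‖B x‖) ^ n * (‖v‖ / n.factorial) := by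
          refine intervalIntegral.norm_integral_le_of_norm_le hst
            (Eventually.of_forall fun τ hτ => ?_) ?_
          · calc ‖B τ (dysonTerm (fun τ => (B τ : E →ₗ[ℂ] E)) v n τ s)‖
                ≤ ‖B τ‖ * ((∫ x in s..τ, ‖B x‖) ^ n / n.factorial * ‖v‖) :=
                  (B τ).le_of_opNorm_le_of_le le_rfl (ih hτ.1.le)
              _ = _ := by ring
          · exact ((hBn.intervalIntegrable_real s t).mul_continuousOn (hcont.pow n).continuousOn).mul_const _
      _ = (∫ x in s..t, ‖B x‖) ^ (n + 1) / (n + 1).factorial * ‖v‖ := by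
          rw [intervalIntegral.integral_mul_const, integral_mul_primitive_pow hBn,
            Nat.factorial_succ]
          push_cast
          field_simp

/-- A bound uniform in `t` up to `T`, as needed for uniform convergence and for exchanging sum and
integral. -/
theorem norm_dysonTerm_le_of_le {B : ℝ → E →L[ℂ] E} (hB : LocallyIntegrable B volume) (v : E)
    {s t T : ℝ} (hst : s ≤ t) (htT : t ≤ T) (n : ℕ) :
    ‖dysonTerm (fun τ => (B τ : E →ₗ[ℂ] E)) v n t s‖
      ≤ (∫ x in s..T, ‖B x‖) ^ n / n.factorial * ‖v‖ := by
  refine (norm_dysonTerm_le hB v s n hst).trans ?_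
  have h0 : 0 ≤ ∫ x in s..t, ‖B x‖ := intervalIntegral.integral_nonneg hst fun _ _ => norm_nonneg _
  have h1 : ∫ x in s..t, ‖B x‖ ≤ ∫ x in s..T, ‖B x‖ :=
    intervalIntegral.integral_mono_interval le_rfl hst htT
      (Eventually.of_forall fun _ => norm_nonneg _) (hB.norm_real.intervalIntegrable_real _ _)
  gcongr

variable [CompleteSpace E]

theorem summable_dysonTerm {B : ℝ → E →L[ℂ] E} (hB : LocallyIntegrable B volume) (v : E)
    {s t : ℝ} (hst : s ≤ t) :
    Summable fun n => dysonTerm (fun τ => (B τ : E →ₗ[ℂ] E)) v n t s :=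
  .of_norm_bounded ((Real.summable_pow_div_factorial _).mul_right _)
    (norm_dysonTerm_le hB v s · hst)

theorem continuousOn_timeOrderedExp {B : ℝ → E →L[ℂ] E} (hB : LocallyIntegrable B volume) (v : E)
    (s T : ℝ) :
    ContinuousOn (fun t => timeOrderedExp (fun τ => (B τ : E →ₗ[ℂ] E)) t s v) (Icc s T) :=
  continuousOn_tsum (fun n => (continuous_dysonTerm hB v s n).continuousOn)
    ((Real.summable_pow_div_factorial (∫ x in s..T, ‖B x‖)).mul_right ‖v‖)
    fun n _ ht => norm_dysonTerm_le_of_le hB v ht.1 ht.2 n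

theorem intervalIntegrable_timeOrderedExp {B : ℝ → E →L[ℂ] E} (hB : LocallyIntegrable B volume)
    (v : E) {s T : ℝ} (hsT : s ≤ T) :
    IntervalIntegrable (fun τ => B τ (timeOrderedExp (fun τ => (B τ : E →ₗ[ℂ] E)) τ s v))
      volume s T :=
  ContinuousOn.intervalIntegrable_clm_apply hB
    (by rw [uIcc_of_le hsT]; exact continuousOn_timeOrderedExp hB v s T)

/-- The time-ordered exponential solves the integrated evolution equation. -/
theorem timeOrderedExp_eq_add_integral {B : ℝ → E →L[ℂ] E} (hB : LocallyIntegrable B volume)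
    (v : E) {s t : ℝ} (hst : s ≤ t) :
    timeOrderedExp (fun τ => (B τ : E →ₗ[ℂ] E)) t s v
      = v + ∫ τ in s..t, B τ (timeOrderedExp (fun τ => (B τ : E →ₗ[ℂ] E)) τ s v) := by
  have hterm : HasSum (fun n => dysonTerm (fun τ => (B τ : E →ₗ[ℂ] E)) v (n + 1) t s)
      (∫ τ in s..t, B τ (timeOrderedExp (fun τ => (B τ : E →ₗ[ℂ] E)) τ s v)) := by
    refine intervalIntegral.hasSum_integral_of_dominated_convergence
      (bound := fun n τ => (∫ x in s..t, ‖B x‖) ^ n / n.factorial * ‖v‖ * ‖B τ‖)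
      (fun n => ?_) (fun n => ?_) ?_ ?_ ?_
    · exact (((continuous_dysonTerm hB v s n).continuousOn).intervalIntegrable_clm_apply
        hB).aestronglyMeasurable_restrict_uIoc
    · refine Eventually.of_forall fun τ hτ => ?_
      rw [uIoc_of_le hst] at hτ
      rw [mul_comm]
      exact (B τ).le_of_opNorm_le_of_le le_rfl (norm_dysonTerm_le_of_le hB v hτ.1.le hτ.2 n)
    · exact Eventually.of_forall fun τ _ =>
        ((Real.summable_pow_div_factorial _).mul_right _).mul_right _
    · simp_rw [tsum_mul_right]
      exact (hB.norm_real.intervalIntegrable_real _ _).const_mul _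
    · refine Eventually.of_forall fun τ hτ => ?_
      rw [uIoc_of_le hst] at hτ
      exact (summable_dysonTerm hB v hτ.1.le).hasSum.mapL (B τ)
  rw [← hterm.tsum_eq, timeOrderedExp, (summable_dysonTerm hB v hst).tsum_eq_zero_add]
  rfl

/-- If the generator preserves the kernel of a real-linear map at all times, then so does the
evolution. -/
theorem map_timeOrderedExp_eq_zero {F : Type*} [NormedAddCommGroup F] [NormedSpace ℝ F]
    [CompleteSpace F] {B : ℝ → E →L[ℂ] E} (hB : LocallyIntegrable B volume) (P : E →L[ℝ] F)
    (hP : ∀ t x, P x = 0 → P (B t x) = 0) {v : E} (hv : P v = 0) {s t : ℝ} (hst : s ≤ t) :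
    P (timeOrderedExp (fun τ => (B τ : E →ₗ[ℂ] E)) t s v) = 0 := by
  have hterm : ∀ n t, P (dysonTerm (fun τ => (B τ : E →ₗ[ℂ] E)) v n t s) = 0 := by
    intro n
    induction n with
    | zero => exact fun _ => hv
    | succ n ih =>
      intro t
      have hi := ((continuous_dysonTerm hB v s n).continuousOn
        (s := uIcc s t)).intervalIntegrable_clm_apply hB
      have := P.intervalIntegral_comp_comm hi
      simp only [dysonTerm]
      refine this.symm.trans ?_
      simp [hP _ _ (ih _)]
  have := (summable_dysonTerm hB v hst).hasSum.mapL P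
  simp only [hterm] at this
  exact this.unique hasSum_zero

end DysonSeries

/-! ### Exponential decay along absolutely continuous curves -/

section Decay

open Set Filter Topology

variable {E : Type*} [NormedAddCommGroup E] [NormedSpace ℝ E]

/-- Increments of `N ∘ X` are dominated by `C` times those of the primitive of `‖F‖`, which is
absolutely continuous. -/
theorem LipschitzWith.absolutelyContinuousOnInterval_comp {N : E → ℝ} {C : NNReal}
    (hN : LipschitzWith C N) {X F : ℝ → E} {s T : ℝ} (hsT : s ≤ T)
    (hF : IntervalIntegrable F volume s T) (hX : ∀ t ∈ Icc s T, X t = X s + ∫ τ in s..t, F τ) :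
    AbsolutelyContinuousOnInterval (fun t => N (X t)) s T := by
  have hac := (hF.norm.absolutelyContinuousOnInterval_intervalIntegral
    (c := s) (by simp)).const_mul (C : ℝ)
  have hsub : ∀ x ∈ Icc s T, ∀ y ∈ Icc s T, IntervalIntegrable F volume x y := fun x hx y hy =>
    hF.mono_set (by rw [uIcc_of_le hsT]; exact uIcc_subset_Icc hx hy)
  have key : ∀ x ∈ Icc s T, ∀ y ∈ Icc s T, dist (N (X x)) (N (X y))
      ≤ dist (C * ∫ τ in s..x, ‖F τ‖) (C * ∫ τ in s..y, ‖F τ‖) := by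
    intro x hx y hy
    have hs : s ∈ Icc s T := ⟨le_rfl, hsT⟩
    have h1 : X x - X y = ∫ τ in y..x, F τ := by
      rw [hX x hx, hX y hy, add_sub_add_left_eq_sub,
        intervalIntegral.integral_interval_sub_left (hsub s hs x hx) (hsub s hs y hy)]
    refine (hN.dist_le_mul _ _).trans ?_
    rw [dist_eq_norm, h1, Real.dist_eq, ← mul_sub,
      intervalIntegral.integral_interval_sub_left (hsub s hs x hx).norm (hsub s hs y hy).norm,
      abs_mul, NNReal.abs_eq]
    gcongr
    exact intervalIntegral.norm_integral_le_abs_integral_norm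
  rw [absolutelyContinuousOnInterval_iff] at hac ⊢
  intro ε hε
  obtain ⟨δ, hδ, h⟩ := hac ε hε
  refine ⟨δ, hδ, fun I hI hlt => lt_of_le_of_lt (Finset.sum_le_sum fun i hi => ?_) (h I hI hlt)⟩
  have := hI.1 i hi
  rw [uIcc_of_le hsT] at this
  exact key _ this.1 _ this.2

/-- The product `f t * exp (c t)` is absolutely continuous with derivative `≤ 0` almost everywhere.
-/
theorem AbsolutelyContinuousOnInterval.le_exp_mul_of_deriv_le {f : ℝ → ℝ} {s T c : ℝ}
    (hsT : s ≤ T) (hf : AbsolutelyContinuousOnInterval f s T)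
    (hder : ∀ᵐ t, t ∈ Ioo s T → ∀ f', HasDerivAt f f' t → f' ≤ -c * f t) :
    f T ≤ Real.exp (-c * (T - s)) * f s := by
  have hexp : AbsolutelyContinuousOnInterval (fun t => Real.exp (c * t)) s T :=
    ContDiffOn.absolutelyContinuousOnInterval (by fun_prop)
  have hprod := hf.fun_mul hexp
  have hftc := hprod.integral_deriv_eq_sub
  have hle : ∫ t in s..T, deriv (fun t => f t * Real.exp (c * t)) t ≤ 0 := by
    rw [intervalIntegral.integral_of_le hsT, integral_Ioc_eq_integral_Ioo]
    refine integral_nonpos_of_ae ?_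
    rw [EventuallyLE, ae_restrict_iff' measurableSet_Ioo]
    filter_upwards [hder, hf.ae_differentiableAt] with t h1 h2 ht
    have h3 := (h2 (by rw [uIcc_of_le hsT]; exact Ioo_subset_Icc_self ht)).hasDerivAt
    have h4 : HasDerivAt (fun t => Real.exp (c * t)) (Real.exp (c * t) * c) t := by
      simpa using ((hasDerivAt_id t).const_mul c).exp
    rw [(h3.fun_mul h4).deriv, Pi.zero_apply]
    nlinarith [h1 ht _ h3, Real.exp_pos (c * t)]
  rw [hftc] at hle
  have h5 : Real.exp (-c * (T - s)) * f s * Real.exp (c * T) = f s * Real.exp (c * s) := by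
    rw [mul_right_comm, ← Real.exp_add, mul_comm]
    ring_nf
  refine le_of_mul_le_mul_right ?_ (Real.exp_pos (c * T))
  rw [h5]
  linarith

/-- Exponential decay of a Lipschitz function along an absolutely continuous curve, from a
supporting functional at each time that decreases at the given rate. -/
theorem LipschitzWith.le_exp_mul_of_supporting [CompleteSpace E] {N : E → ℝ} {C : NNReal}
    (hN : LipschitzWith C N) {X F : ℝ → E} {s T c : ℝ} (hsT : s ≤ T)
    (hF : IntervalIntegrable F volume s T) (hX : ∀ t ∈ Icc s T, X t = X s + ∫ τ in s..t, F τ)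
    (hsupp : ∀ t ∈ Icc s T, ∃ φ : E →L[ℝ] ℝ,
      (∀ x, φ x ≤ N x) ∧ φ (X t) = N (X t) ∧ φ (F t) ≤ -c * N (X t)) :
    N (X T) ≤ Real.exp (-c * (T - s)) * N (X s) := by
  refine (hN.absolutelyContinuousOnInterval_comp hsT hF hX).le_exp_mul_of_deriv_le hsT ?_
  filter_upwards [hF.ae_hasDerivAt_integral] with t ht htI f' hf'
  rw [uIcc_of_le hsT] at ht
  have htm := Ioo_subset_Icc_self htI
  obtain ⟨φ, hle, heq, hdec⟩ := hsupp t htm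
  have hXd : HasDerivAt X (F t) t := by
    refine ((ht htm s ⟨le_rfl, hsT⟩).const_add (X s)).congr_of_eventuallyEq ?_
    filter_upwards [Icc_mem_nhds htI.1 htI.2] with r hr using hX r hr
  have hφ : HasDerivAt (fun r => φ (X r)) (φ (F t)) t := φ.hasFDerivAt.comp_hasDerivAt t hXd
  -- The supporting functional touches `N` from below at `X t`, so at a point of differentiability
  -- both have the same derivative along the curve.
  have hmin : IsLocalMin (fun r => N (X r) - φ (X r)) t := by
    refine Eventually.of_forall fun r => ?_
    simp only [heq, sub_self]
    linarith [hle (X r)]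
  have := hmin.hasDerivAt_eq_zero (hf'.fun_sub hφ)
  linarith

end Decay

/-! ### Hermitian contractions and the derivative of the trace norm -/

section ContractionBall

open Matrix

variable {d : ℕ}

/-- The Hermitian contractions. -/
def hermitianContractions (d : ℕ) : Set (Matrix (Fin d) (Fin d) ℂ) :=
  {S | (1 - S).PosSemidef ∧ (1 + S).PosSemidef}

theorem hermitianContractions.isHermitian {S : Matrix (Fin d) (Fin d) ℂ}
    (hS : S ∈ hermitianContractions d) : S.IsHermitian := by
  have := hS.1.isHermitian.sub (isHermitian_one (n := Fin d) (α := ℂ))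
  simpa using this.neg

theorem hermitianContractions.zero_mem : (0 : Matrix (Fin d) (Fin d) ℂ) ∈ hermitianContractions d :=
  ⟨by simpa using PosSemidef.one, by simpa using PosSemidef.one⟩

theorem Matrix.PosSemidef.exists_eq_conjTranspose_mul_self {A : Matrix (Fin d) (Fin d) ℂ}
    (hA : A.PosSemidef) : ∃ B : Matrix (Fin d) (Fin d) ℂ, A = Bᴴ * B := by
  open scoped MatrixOrder Matrix.Norms.L2Operator in
  exact CStarAlgebra.nonneg_iff_eq_star_mul_self.mp hA.nonneg

/-- Factoring both positive matrices turns the trace into a squared Frobenius norm. This yields its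
nonnegativity and, since `M = 0` when it vanishes, the equality case `X L P = 0`. -/
theorem Matrix.PosSemidef.exists_trace_conj_mul_eq {X P : Matrix (Fin d) (Fin d) ℂ}
    (hX : X.PosSemidef) (hP : P.PosSemidef) (L : Matrix (Fin d) (Fin d) ℂ) :
    ∃ A B M : Matrix (Fin d) (Fin d) ℂ, X * L * P = A * M * B ∧
      (X * L * P * Lᴴ).trace = (Mᴴ * M).trace := by
  obtain ⟨A, rfl⟩ := hX.exists_eq_conjTranspose_mul_self
  obtain ⟨B, rfl⟩ := hP.exists_eq_conjTranspose_mul_self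
  refine ⟨Aᴴ, B, A * L * Bᴴ, by simp only [Matrix.mul_assoc], ?_⟩
  simp only [conjTranspose_mul, conjTranspose_conjTranspose, Matrix.mul_assoc]
  rw [Matrix.trace_mul_comm]
  simp only [Matrix.mul_assoc]
  rw [← Matrix.mul_assoc, ← Matrix.mul_assoc, Matrix.trace_mul_comm]
  simp only [Matrix.mul_assoc]

theorem Matrix.PosSemidef.re_trace_conj_mul_nonneg {X P : Matrix (Fin d) (Fin d) ℂ}
    (hX : X.PosSemidef) (hP : P.PosSemidef) (L : Matrix (Fin d) (Fin d) ℂ) :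
    0 ≤ (X * L * P * Lᴴ).trace.re := by
  obtain ⟨A, B, M, -, h⟩ := hX.exists_trace_conj_mul_eq hP L
  rw [h]
  exact (Complex.le_def.mp (posSemidef_conjTranspose_mul_self M).trace_nonneg).1

theorem Matrix.PosSemidef.mul_eq_zero_of_re_trace {X P L : Matrix (Fin d) (Fin d) ℂ}
    (hX : X.PosSemidef) (hP : P.PosSemidef) (h0 : (X * L * P * Lᴴ).trace.re ≤ 0) :
    X * L * P = 0 := by
  obtain ⟨A, B, M, hM, h⟩ := hX.exists_trace_conj_mul_eq hP L
  rw [h] at h0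
  have h1 := Complex.le_def.mp (posSemidef_conjTranspose_mul_self M).trace_nonneg
  have h2 : (Mᴴ * M).trace = 0 := Complex.ext (le_antisymm h0 h1.1) h1.2.symm
  rw [hM, trace_conjTranspose_mul_self_eq_zero_iff.mp h2]
  simp

/-- The Jordan decomposition of a Hermitian matrix, together with its sign. -/
theorem Matrix.IsHermitian.exists_jordan {X : Matrix (Fin d) (Fin d) ℂ} (hX : X.IsHermitian) :
    ∃ P Q S : Matrix (Fin d) (Fin d) ℂ, P.PosSemidef ∧ Q.PosSemidef ∧ X = P - Q ∧
      S ∈ hermitianContractions d ∧ S * X = P + Q := by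
  let U : Matrix (Fin d) (Fin d) ℂ := hX.eigenvectorUnitary
  have hU : Uᴴ * U = 1 := Unitary.coe_star_mul_self hX.eigenvectorUnitary
  have hU' : U * Uᴴ = 1 := Unitary.coe_mul_star_self hX.eigenvectorUnitary
  let ev := hX.eigenvalues
  -- Functional calculus in an eigenbasis of `X`; the witnesses are the positive part, the negative
  -- part and the sign of the eigenvalues.
  let D : (Fin d → ℝ) → Matrix (Fin d) (Fin d) ℂ := fun f => U * diagonal (fun i => (f i : ℂ)) * Uᴴ
  have hXD : X = D ev := by
    have := hX.spectral_theorem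
    rw [Unitary.conjStarAlgAut_apply] at this
    exact this
  have hD : ∀ f : Fin d → ℝ, 0 ≤ f → (D f).PosSemidef := by
    intro f hf
    refine (PosSemidef.diagonal ?_).mul_mul_conjTranspose_same U
    intro i
    simpa using hf i
  have hadd : ∀ f g, D f + D g = D (f + g) := by
    intro f g
    simp only [D]
    rw [← Matrix.add_mul, ← Matrix.mul_add, diagonal_add]
    simp
  have hsub : ∀ f g, D f - D g = D (f - g) := by
    intro f g
    simp only [D]
    rw [← Matrix.sub_mul, ← Matrix.mul_sub, diagonal_sub]
    simp
  have hmul : ∀ f g, D f * D g = D (f * g) := by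
    intro f g
    simp only [D]
    calc _ = U * diagonal (fun i => (f i : ℂ)) * (Uᴴ * U) * diagonal (fun i => (g i : ℂ)) * Uᴴ := by
          simp only [Matrix.mul_assoc]
      _ = _ := by
          rw [hU, Matrix.mul_one, Matrix.mul_assoc U, diagonal_mul_diagonal]
          simp
  have hone : D 1 = 1 := by simp [D, hU']
  refine ⟨D (fun i => max (ev i) 0), D (fun i => max (-ev i) 0), D (fun i => SignType.sign (ev i)),
    hD _ fun i => le_max_right _ _, hD _ fun i => le_max_right _ _, ?_, ⟨?_, ?_⟩, ?_⟩
  · rw [hsub, hXD]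
    congr 1
    ext i
    simp only [Pi.sub_apply]
    grind
  · rw [← hone, hsub]
    refine hD _ fun i => ?_
    rcases lt_trichotomy (ev i) 0 with h | h | h <;> simp [h]
  · rw [← hone, hadd]
    refine hD _ fun i => ?_
    rcases lt_trichotomy (ev i) 0 with h | h | h <;> simp [h]
  · nth_rw 1 [hXD]
    rw [hmul, hadd]
    congr 1
    ext i
    simp only [Pi.add_apply, Pi.mul_apply, sign_mul_self]
    grind

/-- A Hermitian contraction `S` at which `Re tr (S X)` is maximal acts as the sign of `X` on the two
parts of the Jordan decomposition of `X`. -/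
theorem Matrix.IsHermitian.exists_jordan_of_isMaxOn {X S : Matrix (Fin d) (Fin d) ℂ}
    (hX : X.IsHermitian) (hS : S ∈ hermitianContractions d)
    (hmax : ∀ S' ∈ hermitianContractions d, (S' * X).trace.re ≤ (S * X).trace.re) :
    ∃ P Q : Matrix (Fin d) (Fin d) ℂ, P.PosSemidef ∧ Q.PosSemidef ∧ X = P - Q ∧
      S * P = P ∧ S * Q = -Q := by
  obtain ⟨P, Q, S₀, hP, hQ, hXPQ, hS₀, hS₀X⟩ := hX.exists_jordan
  -- Comparison with the sign `S₀` bounds `tr ((1 - S) P) + tr ((1 + S) Q)` above by `0` in real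
  -- part; both terms are nonnegative, so both are in the equality case.
  have h := hmax S₀ hS₀
  have h1 := hS.1.re_trace_conj_mul_nonneg hP 1
  have h2 := hS.2.re_trace_conj_mul_nonneg hQ 1
  rw [hS₀X, hXPQ] at h
  have h3 := hS.1.mul_eq_zero_of_re_trace (L := 1) hP
  have h4 := hS.2.mul_eq_zero_of_re_trace (L := 1) hQ
  simp only [Matrix.mul_one, conjTranspose_one, Matrix.sub_mul, Matrix.add_mul, Matrix.one_mul,
    Matrix.mul_sub, trace_sub, trace_add, Complex.sub_re, Complex.add_re] at h h1 h2 h3 h4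
  refine ⟨P, Q, hP, hQ, hXPQ, (sub_eq_zero.mp (h3 (by linarith))).symm, ?_⟩
  rw [eq_neg_iff_add_eq_zero, add_comm]
  exact h4 (by linarith)

theorem trace_mul_hamiltonianPart_eq_zero {S X : Matrix (Fin d) (Fin d) ℂ} (h : S * X = X * S)
    (H : Matrix (Fin d) (Fin d) ℂ) : (S * hamiltonianPart H X).trace = 0 := by
  have : (S * (H * X)).trace = (S * (X * H)).trace := by
    rw [← Matrix.mul_assoc S X, h, Matrix.mul_assoc, Matrix.trace_mul_comm X, Matrix.mul_assoc]
  simp [hamiltonianPart, Matrix.mul_sub, trace_sub, trace_smul, this]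

/-- Since `S (P - Q) = (P - Q) S = P + Q`, both halves of the anticommutator give `tr (L (P + Q)
L†)` by cyclicity. -/
theorem trace_mul_jumpDissipator {S P Q L : Matrix (Fin d) (Fin d) ℂ} (hSP : S * P = P)
    (hSQ : S * Q = -Q) (hPS : P * S = P) (hQS : Q * S = -Q) :
    (S * jumpDissipator L (P - Q)).trace
      = -(((1 - S) * L * P * Lᴴ).trace + ((1 + S) * L * Q * Lᴴ).trace) := by
  have e1 : S * (P - Q) = P + Q := by rw [Matrix.mul_sub, hSP, hSQ, sub_neg_eq_add]
  have e2 : (P - Q) * S = P + Q := by rw [Matrix.sub_mul, hPS, hQS, sub_neg_eq_add]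
  have h1 : (S * (Lᴴ * L * (P - Q))).trace = (L * P * Lᴴ).trace + (L * Q * Lᴴ).trace := by
    rw [← Matrix.mul_assoc, Matrix.trace_mul_comm, ← Matrix.mul_assoc, e2, Matrix.trace_mul_comm,
      Matrix.mul_assoc, Matrix.trace_mul_comm, ← trace_add]
    simp only [Matrix.mul_add, Matrix.add_mul]
  have h2 : (S * ((P - Q) * (Lᴴ * L))).trace = (L * P * Lᴴ).trace + (L * Q * Lᴴ).trace := by
    rw [← Matrix.mul_assoc, e1, Matrix.trace_mul_comm,
      Matrix.mul_assoc, Matrix.trace_mul_comm, ← trace_add]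
    simp only [Matrix.mul_add, Matrix.add_mul]
  simp only [jumpDissipator, LinearMap.sub_apply, LinearMap.comp_apply, LinearMap.mulLeft_apply,
    LinearMap.mulRight_apply, LinearMap.smul_apply, LinearMap.add_apply, Matrix.mul_sub S,
    Matrix.mul_smul, Matrix.mul_add S, trace_sub, trace_smul, trace_add, h1, h2]
  simp only [Matrix.sub_mul, Matrix.add_mul, Matrix.mul_sub, Matrix.one_mul, trace_sub, trace_add,
    Matrix.mul_assoc, smul_eq_mul]
  ring

theorem trace_mul_dissipator {m : ℕ} (L : Fin m → Matrix (Fin d) (Fin d) ℂ)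
    {S P Q : Matrix (Fin d) (Fin d) ℂ} (hSP : S * P = P)
    (hSQ : S * Q = -Q) (hPS : P * S = P) (hQS : Q * S = -Q) :
    (S * dissipator L (P - Q)).trace
      = -∑ j, (((1 - S) * L j * P * (L j)ᴴ).trace + ((1 + S) * L j * Q * (L j)ᴴ).trace) := by
  simp only [dissipator, LinearMap.sum_apply, Matrix.mul_sum, trace_sum,
    trace_mul_jumpDissipator hSP hSQ hPS hQS, Finset.sum_neg_distrib]

end ContractionBall

/-! ### Invariant subspaces and strict decrease in dimension 3 -/

section InvariantSubspace

open Matrix Module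

variable {d : ℕ}

theorem adjoin_ne_top_of_forall_mulVec_mem {s : Set (Matrix (Fin d) (Fin d) ℂ)}
    (V : Submodule ℂ (Fin d → ℂ)) (hbot : V ≠ ⊥) (htop : V ≠ ⊤)
    (hs : ∀ M ∈ s, ∀ v ∈ V, M *ᵥ v ∈ V) : Algebra.adjoin ℂ s ≠ ⊤ := by
  intro h
  have hall : ∀ M : Matrix (Fin d) (Fin d) ℂ, ∀ v ∈ V, M *ᵥ v ∈ V := by
    intro M
    have hM : M ∈ Algebra.adjoin ℂ s := h ▸ Algebra.mem_top
    induction hM using Algebra.adjoin_induction with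
    | mem M hM => exact hs M hM
    | algebraMap r =>
      intro v hv
      rw [Algebra.algebraMap_eq_smul_one, smul_mulVec, one_mulVec]
      exact V.smul_mem r hv
    | add M M' _ _ h1 h2 =>
      intro v hv
      rw [add_mulVec]
      exact V.add_mem (h1 v hv) (h2 v hv)
    | mul M M' _ _ h1 h2 =>
      intro v hv
      rw [← mulVec_mulVec]
      exact h1 _ (h2 v hv)
  obtain ⟨v, hv, hv0⟩ := V.ne_bot_iff.mp hbot
  obtain ⟨i, hi⟩ := Function.ne_iff.mp hv0
  refine htop (eq_top_iff.mpr fun w _ => ?_)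
  -- A rank-one matrix sending `v` to the arbitrary vector `w`.
  have := hall (vecMulVec w (Pi.single i (v i)⁻¹)) v hv
  rw [vecMulVec_mulVec, single_dotProduct, inv_mul_cancel₀ hi] at this
  simpa using this

/-- The nonzero range of `P` lies in a fixed space of dimension at most one, hence fills it. So
`hs`, which only controls `M` on that range, makes the whole fixed space invariant. -/
theorem adjoin_ne_top_of_finrank_fixed_le_one {s : Set (Matrix (Fin d) (Fin d) ℂ)}
    (hd : 2 ≤ d) {S P : Matrix (Fin d) (Fin d) ℂ} (hP0 : P ≠ 0) (hSP : S * P = P)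
    (hs : ∀ M ∈ s, S * (M * P) = M * P)
    (hrank : finrank ℂ (LinearMap.ker (mulVecLin (1 - S))) ≤ 1) : Algebra.adjoin ℂ s ≠ ⊤ := by
  set V := LinearMap.ker (mulVecLin (1 - S)) with hV
  have hmem : ∀ v, v ∈ V ↔ S *ᵥ v = v := by
    intro v
    rw [hV, LinearMap.mem_ker, mulVecLin_apply, sub_mulVec, one_mulVec, sub_eq_zero, eq_comm]
  have hle : LinearMap.range P.mulVecLin ≤ V := by
    rintro _ ⟨v, rfl⟩
    rw [hmem, mulVecLin_apply, mulVec_mulVec, hSP]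
  have hpos : 0 < finrank ℂ (LinearMap.range P.mulVecLin) := by
    rw [Module.finrank_pos_iff, Submodule.nontrivial_iff_ne_bot, ne_eq, LinearMap.range_eq_bot]
    exact fun h => hP0 ((LinearEquiv.map_eq_zero_iff toLin').mp h)
  have heq : LinearMap.range P.mulVecLin = V :=
    Submodule.eq_of_le_of_finrank_le hle (by lia)
  refine adjoin_ne_top_of_forall_mulVec_mem V ?_ ?_ ?_
  · rw [← heq]
    intro h
    rw [h, finrank_bot] at hpos
    exact hpos.false
  · intro h
    rw [h, finrank_top, finrank_fin_fun] at hrank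
    lia
  · intro M hM v hv
    rw [← heq] at hv
    obtain ⟨w, rfl⟩ := hv
    rw [hmem, mulVecLin_apply, mulVec_mulVec, mulVec_mulVec, Matrix.mul_assoc, hs M hM,
      mulVec_mulVec]

theorem finrank_ker_one_sub_add_finrank_ker_one_add_le (S : Matrix (Fin d) (Fin d) ℂ) :
    finrank ℂ (LinearMap.ker (mulVecLin (1 - S))) + finrank ℂ (LinearMap.ker (mulVecLin (1 + S)))
      ≤ d := by
  have hdisj : Disjoint (LinearMap.ker (mulVecLin (1 - S))) (LinearMap.ker (mulVecLin (1 + S))) := by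
    rw [Submodule.disjoint_def]
    intro v h1 h2
    rw [LinearMap.mem_ker, mulVecLin_apply, sub_mulVec, one_mulVec] at h1
    rw [LinearMap.mem_ker, mulVecLin_apply, add_mulVec, one_mulVec] at h2
    have : (2 : ℂ) • v = 0 := by
      rw [two_smul]
      linear_combination (exp := 1) h1 + h2
    simpa using this
  simpa using Submodule.finrank_add_finrank_le_of_disjoint hdisj

/-- If the jump operators generate the algebra of `3 × 3` matrices, then the dissipator strictly
decreases the trace norm of every traceless Hermitian matrix to first order. -/
theorem re_trace_mul_dissipator_neg {m : ℕ} {L : Fin m → Matrix (Fin 3) (Fin 3) ℂ}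
    (hL : Algebra.adjoin ℂ (Set.range L) = ⊤) {X S : Matrix (Fin 3) (Fin 3) ℂ}
    (hX : X.IsHermitian) (htr : X.trace = 0) (hX0 : X ≠ 0) (hS : S ∈ hermitianContractions 3)
    (hmax : ∀ S' ∈ hermitianContractions 3, (S' * X).trace.re ≤ (S * X).trace.re) :
    (S * dissipator L X).trace.re < 0 := by
  obtain ⟨P, Q, hP, hQ, rfl, hSP, hSQ⟩ := hX.exists_jordan_of_isMaxOn hS hmax
  have hSH := hermitianContractions.isHermitian hS
  have hPS : P * S = P := by simpa [hSH.eq, hP.isHermitian.eq] using congrArg conjTranspose hSP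
  have hQS : Q * S = -Q := by simpa [hSH.eq, hQ.isHermitian.eq] using congrArg conjTranspose hSQ
  have hn1 := fun j => hS.1.re_trace_conj_mul_nonneg hP (L j)
  have hn2 := fun j => hS.2.re_trace_conj_mul_nonneg hQ (L j)
  rw [trace_mul_dissipator L hSP hSQ hPS hQS, Complex.neg_re, Complex.re_sum, neg_lt_zero]
  simp only [Complex.add_re]
  by_contra hcon
  have hsum := (Finset.sum_eq_zero_iff_of_nonneg
    (fun j _ => add_nonneg (hn1 j) (hn2 j))).mp
    (le_antisymm (not_lt.mp hcon) (Finset.sum_nonneg fun j _ => add_nonneg (hn1 j) (hn2 j)))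
  have hz1 : ∀ j, (1 - S) * L j * P = 0 := fun j => hS.1.mul_eq_zero_of_re_trace hP (by
    linarith [hsum j (Finset.mem_univ j), hn2 j])
  have hz2 : ∀ j, (1 + S) * L j * Q = 0 := fun j => hS.2.mul_eq_zero_of_re_trace hQ (by
    linarith [hsum j (Finset.mem_univ j), hn1 j])
  -- Equal traces: if one of `P`, `Q` vanished, so would the other, and `X` with them.
  have htPQ : P.trace = Q.trace := by rwa [trace_sub, sub_eq_zero] at htr
  have hP0 : P ≠ 0 := by
    rintro rfl
    rw [trace_zero, eq_comm, hQ.trace_eq_zero_iff] at htPQ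
    exact hX0 (by simp [htPQ])
  have hQ0 : Q ≠ 0 := by
    rintro rfl
    rw [trace_zero, hP.trace_eq_zero_iff] at htPQ
    exact hX0 (by simp [htPQ])
  have hdim := finrank_ker_one_sub_add_finrank_ker_one_add_le S
  -- The eigenspaces for `1` and `-1` have total dimension at most 3, so they cannot both have
  -- dimension 2 or more. The first case is the second with `(-S, Q)` for `(S, P)`.
  rcases Nat.lt_or_ge 1 (finrank ℂ (LinearMap.ker (mulVecLin (1 - S)))) with h | h
  · refine adjoin_ne_top_of_finrank_fixed_le_one (S := -S) (by norm_num) hQ0 ?_ ?_ ?_ hL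
    · rw [Matrix.neg_mul, hSQ, neg_neg]
    · rintro _ ⟨j, rfl⟩
      have := hz2 j
      rw [Matrix.add_mul, Matrix.add_mul, Matrix.one_mul, Matrix.mul_assoc] at this
      rw [Matrix.neg_mul, neg_eq_iff_add_eq_zero, add_comm, this]
    · rw [sub_neg_eq_add]
      lia
  · refine adjoin_ne_top_of_finrank_fixed_le_one (by norm_num) hP0 hSP ?_ h hL
    rintro _ ⟨j, rfl⟩
    have := hz1 j
    rw [Matrix.sub_mul, Matrix.sub_mul, Matrix.one_mul, Matrix.mul_assoc, sub_eq_zero] at this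
    exact this.symm

end InvariantSubspace

/-! ### The trace norm as a support function; uniform rate -/

section SupportFunction

open Matrix Filter Topology
open scoped Matrix.Norms.Frobenius

variable {d : ℕ}

theorem frobenius_norm_sq_eq_re_trace (A : Matrix (Fin d) (Fin d) ℂ) :
    ‖A‖ ^ 2 = (Aᴴ * A).trace.re := by
  rw [frobenius_norm_def, ← Real.sqrt_eq_rpow, Real.sq_sqrt (by positivity), Finset.sum_comm]
  simp only [trace, diag_apply, mul_apply, conjTranspose_apply, Complex.re_sum]
  refine Finset.sum_congr rfl fun i _ => Finset.sum_congr rfl fun j _ => ?_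
  rw [Real.rpow_two, ← Complex.normSq_eq_norm_sq, Complex.star_def, ← Complex.normSq_eq_conj_mul_self,
    Complex.ofReal_re]

theorem sum_eigenvalues_conjTranspose_mul_self (X : Matrix (Fin d) (Fin d) ℂ) :
    ∑ i, (isHermitian_conjTranspose_mul_self X).eigenvalues i = ‖X‖ ^ 2 := by
  rw [frobenius_norm_sq_eq_re_trace,
    (isHermitian_conjTranspose_mul_self X).trace_eq_sum_eigenvalues, Complex.re_sum]
  rfl

/-- The `ℓ²` norm of the singular values is at most their `ℓ¹` norm. With the converse bound below,
estimates transfer to `traceNorm` at the cost of a constant. -/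
theorem frobenius_norm_le_traceNorm (X : Matrix (Fin d) (Fin d) ℂ) : ‖X‖ ≤ traceNorm X := by
  refine le_of_sq_le_sq ?_ (Finset.sum_nonneg fun _ _ => Real.sqrt_nonneg _)
  rw [← sum_eigenvalues_conjTranspose_mul_self, traceNorm]
  refine le_trans (Finset.sum_le_sum fun i _ => ?_)
    (Finset.sum_sq_le_sq_sum_of_nonneg fun i _ => Real.sqrt_nonneg _)
  rw [Real.sq_sqrt (eigenvalues_conjTranspose_mul_self_nonneg X i)]

theorem traceNorm_le_mul_frobenius_norm (X : Matrix (Fin d) (Fin d) ℂ) :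
    traceNorm X ≤ d * ‖X‖ := by
  have h : ∀ i ∈ Finset.univ, √((isHermitian_conjTranspose_mul_self X).eigenvalues i) ≤ ‖X‖ := by
    intro i hi
    rw [← Real.sqrt_sq (norm_nonneg X), ← sum_eigenvalues_conjTranspose_mul_self]
    exact Real.sqrt_le_sqrt (Finset.single_le_sum
      (fun j _ => eigenvalues_conjTranspose_mul_self_nonneg X j) hi)
  simpa [traceNorm] using Finset.sum_le_card_nsmul _ _ _ h

theorem Matrix.PosSemidef.frobenius_norm_le_re_trace {P : Matrix (Fin d) (Fin d) ℂ}
    (hP : P.PosSemidef) : ‖P‖ ≤ P.trace.re := by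
  obtain ⟨B, rfl⟩ := hP.exists_eq_conjTranspose_mul_self
  rw [← frobenius_norm_sq_eq_re_trace]
  refine (norm_mul_le _ _).trans ?_
  rw [frobenius_norm_conjTranspose, sq]

theorem isClosed_setOf_posSemidef : IsClosed {M : Matrix (Fin d) (Fin d) ℂ | M.PosSemidef} := by
  simp only [posSemidef_iff_dotProduct_mulVec, Set.ofPred_and, Set.ofPred_forall, IsHermitian]
  refine IsClosed.inter (isClosed_eq continuous_id.matrix_conjTranspose continuous_id) (isClosed_iInter fun x => ?_)
  exact isClosed_le continuous_const (by fun_prop)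

theorem isClosed_hermitianContractions : IsClosed (hermitianContractions d) :=
  (isClosed_setOf_posSemidef.preimage (continuous_const.sub continuous_id)).inter
    (isClosed_setOf_posSemidef.preimage (continuous_const.add continuous_id))

/-- Expand `0 ≤ tr ((1 - S) (1 + S)) = d - tr S²`. -/
theorem norm_le_of_mem_hermitianContractions {S : Matrix (Fin d) (Fin d) ℂ}
    (hS : S ∈ hermitianContractions d) : ‖S‖ ≤ √d := by
  refine Real.le_sqrt_of_sq_le ?_
  have h := hS.1.re_trace_conj_mul_nonneg hS.2 1
  rw [frobenius_norm_sq_eq_re_trace, (hermitianContractions.isHermitian hS).eq]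
  simp only [Matrix.mul_one, conjTranspose_one, Matrix.sub_mul, Matrix.one_mul, Matrix.mul_add,
    trace_sub, trace_add, trace_one, Complex.sub_re, Complex.add_re, Fintype.card_fin,
    Complex.natCast_re] at h
  linarith

theorem isCompact_hermitianContractions : IsCompact (hermitianContractions d) :=
  Metric.isCompact_of_isClosed_isBounded isClosed_hermitianContractions
    (isBounded_iff_forall_norm_le.mpr ⟨√d, fun _ => norm_le_of_mem_hermitianContractions⟩)

theorem re_trace_le (M : Matrix (Fin d) (Fin d) ℂ) : M.trace.re ≤ √d * ‖M‖ := by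
  have h1 : ∀ i, (M i i).re ^ 2 ≤ ∑ j, ‖M i j‖ ^ 2 := fun i =>
    (sq_le_sq' (neg_le_of_abs_le (Complex.abs_re_le_norm _)) (Complex.re_le_norm _)).trans
      (Finset.single_le_sum (f := fun j => ‖M i j‖ ^ 2) (fun _ _ => by positivity)
        (Finset.mem_univ i))
  have h2 : ‖M‖ ^ 2 = ∑ i, ∑ j, ‖M i j‖ ^ 2 := by
    rw [frobenius_norm_def, ← Real.sqrt_eq_rpow, Real.sq_sqrt (by positivity)]
    simp
  refine le_of_sq_le_sq ?_ (by positivity)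
  calc M.trace.re ^ 2 = (∑ i, (M i i).re) ^ 2 := by simp [trace, Complex.re_sum]
    _ ≤ d * ∑ i, (M i i).re ^ 2 := by
      simpa using sq_sum_le_card_mul_sum_sq (s := Finset.univ) (f := fun i => (M i i).re)
    _ ≤ d * ‖M‖ ^ 2 := by
      rw [h2]
      gcongr
      exact h1 _
    _ = (√d * ‖M‖) ^ 2 := by rw [mul_pow, Real.sq_sqrt (by positivity)]

/-- The real-linear functional `X ↦ Re tr (S X)`. -/
noncomputable def reTraceMul (S : Matrix (Fin d) (Fin d) ℂ) : Matrix (Fin d) (Fin d) ℂ →L[ℝ] ℝ :=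
  (Complex.reLm ∘ₗ ((traceLinearMap (Fin d) ℂ ℂ ∘ₗ LinearMap.mulLeft ℂ S).restrictScalars ℝ)
    : Matrix (Fin d) (Fin d) ℂ →ₗ[ℝ] ℝ).toContinuousLinearMap

theorem reTraceMul_apply (S X : Matrix (Fin d) (Fin d) ℂ) : reTraceMul S X = (S * X).trace.re :=
  rfl

/-- The support function of the set of Hermitian contractions. On Hermitian matrices it is the trace
norm. -/
noncomputable def contractionSupport (X : Matrix (Fin d) (Fin d) ℂ) : ℝ :=
  sSup ((fun S => reTraceMul S X) '' hermitianContractions d)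

theorem exists_contractionSupport_eq (X : Matrix (Fin d) (Fin d) ℂ) :
    ∃ S ∈ hermitianContractions d, contractionSupport X = reTraceMul S X ∧
      ∀ S' ∈ hermitianContractions d, reTraceMul S' X ≤ reTraceMul S X := by
  have hcont : Continuous fun S : Matrix (Fin d) (Fin d) ℂ => reTraceMul S X := by
    simp only [reTraceMul_apply]
    fun_prop
  obtain ⟨S, hS, hmax⟩ := isCompact_hermitianContractions.exists_isMaxOn
    ⟨0, hermitianContractions.zero_mem⟩ hcont.continuousOn
  refine ⟨S, hS, ?_, hmax⟩
  have : IsGreatest ((fun S => reTraceMul S X) '' hermitianContractions d) (reTraceMul S X) :=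
    ⟨⟨S, hS, rfl⟩, by rintro _ ⟨S', hS', rfl⟩; exact hmax hS'⟩
  exact this.csSup_eq

theorem reTraceMul_le_contractionSupport {S : Matrix (Fin d) (Fin d) ℂ}
    (hS : S ∈ hermitianContractions d) (X : Matrix (Fin d) (Fin d) ℂ) :
    reTraceMul S X ≤ contractionSupport X := by
  obtain ⟨S', -, h, hmax⟩ := exists_contractionSupport_eq X
  rw [h]
  exact hmax S hS

theorem exists_contractionSupport_le :
    ∃ C : NNReal, ∀ X : Matrix (Fin d) (Fin d) ℂ, contractionSupport X ≤ C * ‖X‖ := by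
  refine ⟨NNReal.sqrt d * NNReal.sqrt d, fun X => ?_⟩
  obtain ⟨S, hS, h, -⟩ := exists_contractionSupport_eq X
  rw [h, reTraceMul_apply, NNReal.coe_mul, Real.coe_sqrt, NNReal.coe_natCast, mul_assoc]
  calc (S * X).trace.re ≤ √d * ‖S * X‖ := re_trace_le _
    _ ≤ √d * (‖S‖ * ‖X‖) := by gcongr; exact norm_mul_le _ _
    _ ≤ √d * (√d * ‖X‖) := by gcongr; exact norm_le_of_mem_hermitianContractions hS

theorem contractionSupport_le_add_sub (X Y : Matrix (Fin d) (Fin d) ℂ) :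
    contractionSupport X ≤ contractionSupport Y + contractionSupport (X - Y) := by
  obtain ⟨S, hS, h, -⟩ := exists_contractionSupport_eq X
  have h1 := reTraceMul_le_contractionSupport hS Y
  have h2 := reTraceMul_le_contractionSupport hS (X - Y)
  rw [map_sub] at h2
  linarith

theorem exists_lipschitzWith_contractionSupport :
    ∃ C : NNReal, LipschitzWith C (contractionSupport (d := d)) := by
  obtain ⟨C, hC⟩ := exists_contractionSupport_le (d := d)
  refine ⟨C, LipschitzWith.of_le_add_mul C fun X Y => ?_⟩
  rw [dist_eq_norm]
  linarith [contractionSupport_le_add_sub X Y, hC (X - Y)]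

theorem Matrix.IsHermitian.norm_le_contractionSupport {X : Matrix (Fin d) (Fin d) ℂ}
    (hX : X.IsHermitian) : ‖X‖ ≤ contractionSupport X := by
  obtain ⟨P, Q, S, hP, hQ, hPQ, hS, hSX⟩ := hX.exists_jordan
  calc ‖X‖ ≤ ‖P‖ + ‖Q‖ := hPQ ▸ norm_sub_le P Q
    _ ≤ P.trace.re + Q.trace.re :=
      add_le_add hP.frobenius_norm_le_re_trace hQ.frobenius_norm_le_re_trace
    _ = reTraceMul S X := by rw [reTraceMul_apply, hSX, trace_add, Complex.add_re]
    _ ≤ _ := reTraceMul_le_contractionSupport hS X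

/-- A super-operator that decreases the trace norm of every traceless Hermitian matrix to first order
does so at a uniform rate. -/
theorem exists_uniform_rate (D : SuperOp d)
    (hD : ∀ X S : Matrix (Fin d) (Fin d) ℂ, X.IsHermitian → X.trace = 0 → X ≠ 0 →
      S ∈ hermitianContractions d →
      (∀ S' ∈ hermitianContractions d, reTraceMul S' X ≤ reTraceMul S X) →
      reTraceMul S (D X) < 0) :
    ∃ γ > 0, ∀ X S : Matrix (Fin d) (Fin d) ℂ, X.IsHermitian → X.trace = 0 →
      S ∈ hermitianContractions d →
      (∀ S' ∈ hermitianContractions d, reTraceMul S' X ≤ reTraceMul S X) →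
      reTraceMul S (D X) ≤ -γ * contractionSupport X := by
  obtain ⟨C, hC⟩ := exists_contractionSupport_le (d := d)
  -- Taking pairs avoids choosing `S` continuously in `X`: optimality is a family of non-strict
  -- inequalities, so `T` is compact.
  let T : Set (Matrix (Fin d) (Fin d) ℂ × Matrix (Fin d) (Fin d) ℂ) :=
    {p | p.1.IsHermitian ∧ p.1.trace = 0 ∧ ‖p.1‖ = 1 ∧ p.2 ∈ hermitianContractions d ∧
      ∀ S' ∈ hermitianContractions d, reTraceMul S' p.1 ≤ reTraceMul p.2 p.1}
  have hDc : Continuous D := D.continuous_of_finiteDimensional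
  have hTclosed : IsClosed T := by
    simp only [T, Set.ofPred_and, Set.ofPred_forall, IsHermitian, reTraceMul_apply]
    refine (isClosed_eq (by fun_prop) (by fun_prop)).inter <|
      (isClosed_eq (by fun_prop) (by fun_prop)).inter <|
      (isClosed_eq (by fun_prop) (by fun_prop)).inter <|
      (isClosed_hermitianContractions.preimage continuous_snd).inter <|
      isClosed_iInter fun S' => isClosed_iInter fun _ => isClosed_le (by fun_prop) (by fun_prop)
  have hTbdd : T ⊆ Metric.closedBall 0 1 ×ˢ hermitianContractions d := fun p hp =>
    ⟨by simpa using hp.2.2.1.le, hp.2.2.2.1⟩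
  have hT : IsCompact T := ((isCompact_closedBall 0 1).prod
    isCompact_hermitianContractions).of_isClosed_subset hTclosed hTbdd
  have hfc : Continuous fun p : Matrix (Fin d) (Fin d) ℂ × Matrix (Fin d) (Fin d) ℂ =>
      reTraceMul p.2 (D p.1) := by
    simp only [reTraceMul_apply]
    fun_prop
  obtain ⟨c, hc, hcT⟩ : ∃ c > 0, ∀ p ∈ T, reTraceMul p.2 (D p.1) ≤ -c := by
    rcases T.eq_empty_or_nonempty with h | h
    · exact ⟨1, one_pos, by simp [h]⟩
    · obtain ⟨p, hp, hmax⟩ := hT.exists_isMaxOn h hfc.continuousOn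
      refine ⟨-reTraceMul p.2 (D p.1), ?_, fun q hq => by simpa using hmax hq⟩
      refine neg_pos.mpr (hD _ _ hp.1 hp.2.1 ?_ hp.2.2.2.1 hp.2.2.2.2)
      exact fun h0 => by simpa [h0] using hp.2.2.1
  -- `C` converts the Frobenius norm into the support function; the `+ 1` keeps the denominator
  -- positive.
  refine ⟨c / (C + 1), by positivity, fun X S hX htr hS hmax => ?_⟩
  by_cases hX0 : X = 0
  · subst hX0
    have : contractionSupport (0 : Matrix (Fin d) (Fin d) ℂ) = 0 := by
      obtain ⟨S, -, h, -⟩ := exists_contractionSupport_eq (0 : Matrix (Fin d) (Fin d) ℂ)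
      simpa using h
    simp [this]
  · have hn : 0 < ‖X‖ := norm_pos_iff.mpr hX0
    have hp : ((‖X‖⁻¹ : ℝ) • X, S) ∈ T := by
      refine ⟨?_, ?_, ?_, hS, fun S' hS' => ?_⟩
      · simp [IsHermitian, conjTranspose_smul, hX.eq]
      · simp [trace_smul, htr]
      · simp [norm_smul, hn.ne']
      · simp only [map_smul, smul_eq_mul]
        gcongr
        exact hmax S' hS'
    have h1 := hcT _ hp
    simp only [LinearMap.map_smul_of_tower, map_smul, smul_eq_mul] at h1
    have h2 : reTraceMul S (D X) ≤ -c * ‖X‖ := by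
      rw [inv_mul_le_iff₀ hn] at h1
      linarith
    refine h2.trans ?_
    have h3 : c / (C + 1) * contractionSupport X ≤ c * ‖X‖ := by
      calc c / (C + 1) * contractionSupport X ≤ c / (C + 1) * ((C + 1) * ‖X‖) := by
            gcongr
            nlinarith [hC X]
        _ = c * ‖X‖ := by field_simp
    linarith

end SupportFunction

/-! ### The sufficient condition -/

section Contractivity

open Matrix Filter Topology
open scoped Matrix.Norms.Frobenius

variable {d : ℕ}

/-- The topology of the Frobenius norm, which is definitionally the entrywise one. -/
@[reducible]
noncomputable def frobeniusTopology : TopologicalSpace (Matrix (Fin d) (Fin d) ℂ) :=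
  (inferInstance : NormedAddCommGroup (Matrix (Fin d) (Fin d) ℂ)).toMetricSpace
    |>.toPseudoMetricSpace.toUniformSpace.toTopologicalSpace

attribute [local instance] frobeniusTopology

/-- The generator with a time-dependent Hamiltonian, as a continuous linear map. -/
noncomputable def generatorCLM (H : ℝ → Matrix (Fin d) (Fin d) ℂ) (D : SuperOp d) (t : ℝ) :
    Matrix (Fin d) (Fin d) ℂ →L[ℂ] Matrix (Fin d) (Fin d) ℂ :=
  (hamiltonianPart (H t) + D).toContinuousLinearMap

theorem evolution_eq_timeOrderedExp (H : ℝ → Matrix (Fin d) (Fin d) ℂ) (D : SuperOp d) (t s : ℝ)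
    (X : Matrix (Fin d) (Fin d) ℂ) :
    evolution (fun t => hamiltonianPart (H t) + D) t s X
      = timeOrderedExp (fun τ => (generatorCLM H D τ :
          Matrix (Fin d) (Fin d) ℂ →ₗ[ℂ] Matrix (Fin d) (Fin d) ℂ)) t s X :=
  rfl

theorem MeasureTheory.LocallyIntegrable.clm_comp {E F : Type*} [NormedAddCommGroup E]
    [NormedAddCommGroup F] [NormedSpace ℂ E] [NormedSpace ℂ F] {f : ℝ → E}
    (hf : LocallyIntegrable f volume) (φ : E →L[ℂ] F) :
    LocallyIntegrable (fun t => φ (f t)) volume := fun x =>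
  let ⟨s, hs, hfs⟩ := hf x
  ⟨s, hs, φ.integrable_comp hfs⟩

theorem locallyIntegrable_matrix {H : ℝ → Matrix (Fin d) (Fin d) ℂ}
    (hH : ∀ i j, LocallyIntegrable (fun t => H t i j) volume) : LocallyIntegrable H volume := by
  have : H = fun t => ∑ i, ∑ j, H t i j • Matrix.single i j (1 : ℂ) := by
    ext1 t
    conv_lhs => rw [matrix_eq_sum_single (H t)]
    simp [smul_single]
  rw [this]
  exact locallyIntegrable_finsetSum _ fun i _ => locallyIntegrable_finsetSum _ fun j _ =>
    (hH i j).clm_comp ((ContinuousLinearMap.id ℂ ℂ).smulRight (Matrix.single i j (1 : ℂ)))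

theorem locallyIntegrable_generatorCLM {H : ℝ → Matrix (Fin d) (Fin d) ℂ} (hH : IsHamiltonian H)
    (D : SuperOp d) : LocallyIntegrable (generatorCLM H D) volume := by
  let Ψ : Matrix (Fin d) (Fin d) ℂ →ₗ[ℂ]
      (Matrix (Fin d) (Fin d) ℂ →L[ℂ] Matrix (Fin d) (Fin d) ℂ) :=
    { toFun := fun A => (hamiltonianPart A).toContinuousLinearMap
      map_add' := fun A B => by
        ext1 X
        simp only [hamiltonianPart, LinearMap.coe_toContinuousLinearMap', LinearMap.smul_apply,
          LinearMap.sub_apply, LinearMap.mulLeft_apply, LinearMap.mulRight_apply,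
          _root_.add_apply, Matrix.add_mul, Matrix.mul_add, ← smul_add]
        congr 1
        abel
      map_smul' := fun c A => by
        ext1 X
        simp only [hamiltonianPart, LinearMap.coe_toContinuousLinearMap', LinearMap.smul_apply,
          LinearMap.sub_apply, LinearMap.mulLeft_apply, LinearMap.mulRight_apply,
          _root_.smul_apply, Matrix.smul_mul, Matrix.mul_smul, ← smul_sub,
          RingHom.id_apply]
        rw [smul_comm] }
  have h : generatorCLM H D = fun t => Ψ.toContinuousLinearMap (H t) + D.toContinuousLinearMap := by
    ext1 t
    simp [generatorCLM, Ψ]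
  rw [h]
  have hconst : LocallyIntegrable (fun _ : ℝ => D.toContinuousLinearMap) volume :=
    locallyIntegrable_const _
  exact ((locallyIntegrable_matrix hH.locallyIntegrable).clm_comp Ψ.toContinuousLinearMap).add hconst

theorem conjTranspose_hamiltonianPart {A : Matrix (Fin d) (Fin d) ℂ} (hA : A.IsHermitian)
    (X : Matrix (Fin d) (Fin d) ℂ) : (hamiltonianPart A X)ᴴ = hamiltonianPart A Xᴴ := by
  simp only [hamiltonianPart, LinearMap.smul_apply, LinearMap.sub_apply, LinearMap.mulLeft_apply,
    LinearMap.mulRight_apply, conjTranspose_smul, conjTranspose_sub, conjTranspose_mul, hA.eq]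
  simp [smul_sub, neg_add_eq_sub]

theorem conjTranspose_dissipator {m : ℕ} (L : Fin m → Matrix (Fin d) (Fin d) ℂ)
    (X : Matrix (Fin d) (Fin d) ℂ) : (dissipator L X)ᴴ = dissipator L Xᴴ := by
  simp only [dissipator, jumpDissipator, LinearMap.sum_apply, conjTranspose_sum,
    LinearMap.smul_apply, LinearMap.sub_apply, LinearMap.comp_apply, LinearMap.mulLeft_apply,
    LinearMap.add_apply, LinearMap.mulRight_apply, conjTranspose_smul, conjTranspose_sub,
    conjTranspose_add, conjTranspose_mul, conjTranspose_conjTranspose]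
  refine Finset.sum_congr rfl fun j _ => ?_
  rw [add_comm (Xᴴ * _)]
  simp [Matrix.mul_assoc]

/-- The functional `X ↦ tr (F X)` is annihilated by the dual of the dissipator if `F` commutes with
the jump operators and their adjoints. -/
theorem trace_mul_dissipator_eq_zero {m : ℕ} (L : Fin m → Matrix (Fin d) (Fin d) ℂ)
    {F : Matrix (Fin d) (Fin d) ℂ} (h1 : ∀ j, Commute F (L j)) (h2 : ∀ j, Commute F (L j)ᴴ)
    (X : Matrix (Fin d) (Fin d) ℂ) : (F * dissipator L X).trace = 0 := by
  simp only [dissipator, LinearMap.sum_apply, Matrix.mul_sum, trace_sum]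
  refine Finset.sum_eq_zero fun j _ => ?_
  have e1 : (F * (L j * (X * (L j)ᴴ))).trace = (F * ((L j)ᴴ * L j * X)).trace := by
    rw [← Matrix.mul_assoc, ← Matrix.mul_assoc, Matrix.trace_mul_comm, ← Matrix.mul_assoc,
      ← Matrix.mul_assoc, ← (h2 j).eq]
    simp only [Matrix.mul_assoc]
  have e2 : (F * (X * ((L j)ᴴ * L j))).trace = (F * ((L j)ᴴ * L j * X)).trace := by
    rw [← Matrix.mul_assoc, Matrix.trace_mul_comm, ← Matrix.mul_assoc, Matrix.mul_assoc (L j)ᴴ,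
      ← (h1 j).eq, ← Matrix.mul_assoc, ← (h2 j).eq]
    simp only [Matrix.mul_assoc]
  simp only [jumpDissipator, LinearMap.sub_apply, LinearMap.comp_apply, LinearMap.mulLeft_apply,
    LinearMap.mulRight_apply, LinearMap.smul_apply, LinearMap.add_apply, Matrix.mul_sub,
    Matrix.mul_smul, Matrix.mul_add, trace_sub, trace_smul, trace_add, e1, e2, smul_eq_mul]
  ring

theorem trace_dissipator {m : ℕ} (L : Fin m → Matrix (Fin d) (Fin d) ℂ)
    (X : Matrix (Fin d) (Fin d) ℂ) : (dissipator L X).trace = 0 := by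
  simpa using trace_mul_dissipator_eq_zero L (F := 1) (fun _ => Commute.one_left _)
    (fun _ => Commute.one_left _) X

/-- These matrices form the kernel of `X ↦ (X† - X, tr X)`, which every generator preserves; the map
is only real-linear because of the adjoint. -/
theorem hermitian_traceless_evolution {H : ℝ → Matrix (Fin d) (Fin d) ℂ} (hH : IsHamiltonian H)
    {m : ℕ} (L : Fin m → Matrix (Fin d) (Fin d) ℂ) {X : Matrix (Fin d) (Fin d) ℂ}
    (hX : X.IsHermitian) (htr : X.trace = 0) {s t : ℝ} (hst : s ≤ t) :
    (evolution (fun t => hamiltonianPart (H t) + dissipator L) t s X).IsHermitian ∧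
      (evolution (fun t => hamiltonianPart (H t) + dissipator L) t s X).trace = 0 := by
  let P : Matrix (Fin d) (Fin d) ℂ →ₗ[ℝ] Matrix (Fin d) (Fin d) ℂ × ℂ :=
    { toFun := fun X => (Xᴴ - X, X.trace)
      map_add' := fun X Y => by
        ext1
        · simp only [conjTranspose_add, Prod.fst_add]
          abel
        · simp
      map_smul' := fun c X => by
        ext1
        · simp [conjTranspose_smul, smul_sub]
        · simp [trace_smul] }
  have hP : ∀ Y, P Y = 0 ↔ Y.IsHermitian ∧ Y.trace = 0 := fun Y => by
    simp [P, IsHermitian, sub_eq_zero]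
  rw [evolution_eq_timeOrderedExp, ← hP]
  refine map_timeOrderedExp_eq_zero (locallyIntegrable_generatorCLM hH _)
    P.toContinuousLinearMap (fun τ Y hY => ?_) ((hP X).mpr ⟨hX, htr⟩) hst
  obtain ⟨h1, h2⟩ := (hP Y).mp hY
  refine (hP _).mpr ⟨?_, ?_⟩
  · change (hamiltonianPart (H τ) Y + dissipator L Y)ᴴ = hamiltonianPart (H τ) Y + dissipator L Y
    rw [conjTranspose_add, conjTranspose_hamiltonianPart (hH.isHermitian τ),
      conjTranspose_dissipator, h1.eq]
  · have := trace_mul_hamiltonianPart_eq_zero (S := 1) (X := Y) (by simp) (H τ)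
    rw [Matrix.one_mul] at this
    change (hamiltonianPart (H τ) Y + dissipator L Y).trace = 0
    rw [trace_add, trace_dissipator, this, add_zero]

theorem hamiltonianIndependentlyContractive_of_decreasing {m : ℕ}
    (L : Fin m → Matrix (Fin d) (Fin d) ℂ)
    (hD : ∀ X S : Matrix (Fin d) (Fin d) ℂ, X.IsHermitian → X.trace = 0 → X ≠ 0 →
      S ∈ hermitianContractions d →
      (∀ S' ∈ hermitianContractions d, reTraceMul S' X ≤ reTraceMul S X) →
      reTraceMul S (dissipator L X) < 0) :
    HamiltonianIndependentlyContractive (dissipator L) := by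
  obtain ⟨γ, hγ, hrate⟩ := exists_uniform_rate (dissipator L) hD
  obtain ⟨C, hC⟩ := exists_contractionSupport_le (d := d)
  obtain ⟨C', hC'⟩ := exists_lipschitzWith_contractionSupport (d := d)
  -- `d` and `C` come from the norm comparisons, `+ 1` ensures `K > 0`; neither constant depends on
  -- `H`.
  refine fun H hH => ⟨d * C + 1, γ, by positivity, hγ, fun ρ σ hρ hσ s t _ hst => ?_⟩
  have hX : (ρ - σ).IsHermitian := hρ.1.isHermitian.sub hσ.1.isHermitian
  have htr : (ρ - σ).trace = 0 := by rw [trace_sub, hρ.2, hσ.2, sub_self]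
  set X := ρ - σ
  have hB := locallyIntegrable_generatorCLM hH (dissipator L)
  have hinv := fun τ (hτ : s ≤ τ) => hermitian_traceless_evolution hH L hX htr hτ
  set Y := fun τ => evolution (fun t => hamiltonianPart (H t) + dissipator L) τ s X with hY
  have hYs : Y s = X := by
    have := timeOrderedExp_eq_add_integral hB X (le_refl s)
    rwa [intervalIntegral.integral_same, add_zero] at this
  have hdecay : contractionSupport (Y t)
      ≤ Real.exp (-γ * (t - s)) * contractionSupport (Y s) := by
    refine hC'.le_exp_mul_of_supporting (F := fun τ => generatorCLM H (dissipator L) τ (Y τ)) hst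
      (intervalIntegrable_timeOrderedExp hB X hst) (fun τ hτ => ?_) (fun τ hτ => ?_)
    · rw [hYs]
      exact timeOrderedExp_eq_add_integral hB X hτ.1
    · obtain ⟨S, hS, hSN, hmax⟩ := exists_contractionSupport_eq (Y τ)
      obtain ⟨hH1, hT1⟩ := hinv τ hτ.1
      refine ⟨reTraceMul S, reTraceMul_le_contractionSupport hS, hSN.symm, ?_⟩
      obtain ⟨P, Q, hP, hQ, hPQ, hSP, hSQ⟩ := hH1.exists_jordan_of_isMaxOn hS hmax
      have hSH := hermitianContractions.isHermitian hS
      have hPS : P * S = P := by simpa [hSH.eq, hP.isHermitian.eq] using congrArg conjTranspose hSP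
      have hQS : Q * S = -Q := by simpa [hSH.eq, hQ.isHermitian.eq] using congrArg conjTranspose hSQ
      have hcomm : S * Y τ = Y τ * S := by
        rw [show Y τ = P - Q from hPQ, Matrix.mul_sub, Matrix.sub_mul, hSP, hSQ, hPS, hQS]
      have hham : reTraceMul S (hamiltonianPart (H τ) (Y τ)) = 0 := by
        rw [reTraceMul_apply, trace_mul_hamiltonianPart_eq_zero hcomm, Complex.zero_re]
      change reTraceMul S (hamiltonianPart (H τ) (Y τ) + dissipator L (Y τ)) ≤ _
      rw [map_add, hham, zero_add]
      exact hrate _ _ hH1 hT1 hS hmax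
  rw [hYs] at hdecay
  rw [abs_of_nonneg (sub_nonneg.mpr hst)]
  have hX0 : 0 ≤ traceNorm X := (norm_nonneg X).trans (frobenius_norm_le_traceNorm X)
  calc traceNorm (Y t) ≤ d * ‖Y t‖ := traceNorm_le_mul_frobenius_norm _
    _ ≤ d * (Real.exp (-γ * (t - s)) * (C * traceNorm X)) := by
      gcongr
      refine (hinv t hst).1.norm_le_contractionSupport.trans (hdecay.trans ?_)
      gcongr
      refine (hC X).trans ?_
      gcongr
      exact frobenius_norm_le_traceNorm X
    _ = d * C * Real.exp (-γ * (t - s)) * traceNorm X := by ring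
    _ ≤ (d * C + 1) * Real.exp (-γ * (t - s)) * traceNorm X := by
      gcongr
      linarith

theorem hamiltonianIndependentlyContractive_of_adjoin_eq_top {m : ℕ}
    {L : Fin m → Matrix (Fin 3) (Fin 3) ℂ} (hL : Algebra.adjoin ℂ (Set.range L) = ⊤) :
    HamiltonianIndependentlyContractive (dissipator L) :=
  hamiltonianIndependentlyContractive_of_decreasing L fun _ _ hX htr hX0 hS hmax =>
    re_trace_mul_dissipator_neg hL hX htr hX0 hS hmax

end Contractivity

/-! ### Commutants of self-adjoint algebras -/

section Commutant

open Module

variable {E : Type*} [NormedAddCommGroup E] [InnerProductSpace ℂ E] [FiniteDimensional ℂ E]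

/-- The orthogonal complement of an invariant subspace is invariant, because the algebra contains
adjoints. -/
theorem isSemisimpleModule_of_adjoint_mem (A : Subalgebra ℂ (End ℂ E))
    (hA : ∀ a ∈ A, LinearMap.adjoint a ∈ A) : IsSemisimpleModule A E := by
  refine (isSemisimpleModule_iff A E).mpr ⟨fun N => ?_⟩
  let N₀ : Submodule ℂ E := N.restrictScalars ℂ
  let N' : Submodule A E :=
    { N₀ᗮ with
      smul_mem' := fun a x hx => by
        intro y hy
        have : inner ℂ y (a.1 x) = 0 := by
          rw [← LinearMap.adjoint_inner_left]
          exact hx _ (N.smul_mem (⟨_, hA a.1 a.2⟩ : A) hy)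
        exact this }
  have hmem : ∀ x, x ∈ N' ↔ x ∈ N₀ᗮ := fun _ => Iff.rfl
  refine ⟨N', IsCompl.of_eq ?_ ?_⟩
  · rw [eq_bot_iff]
    intro x hx
    have : x ∈ N₀ ⊓ N₀ᗮ := ⟨hx.1, hx.2⟩
    rw [Submodule.inf_orthogonal_eq_bot] at this
    exact this
  · rw [eq_top_iff]
    intro x _
    have : x ∈ N₀ ⊔ N₀ᗮ := by
      rw [Submodule.sup_orthogonal_of_hasOrthogonalProjection]
      trivial
    obtain ⟨y, hy, z, hz, rfl⟩ := Submodule.mem_sup.mp this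
    exact Submodule.add_mem_sup (show y ∈ N from hy) (show z ∈ N' from hz)

/-- A proper self-adjoint algebra of operators on a finite-dimensional Hilbert space commutes with
an operator that is not a scalar. -/
theorem exists_commute_ne_smul_one (A : Subalgebra ℂ (End ℂ E))
    (hA : ∀ a ∈ A, LinearMap.adjoint a ∈ A) (htop : A ≠ ⊤) :
    ∃ f : End ℂ E, (∀ a ∈ A, Commute f a) ∧ ∀ c : ℂ, f ≠ c • 1 := by
  have := isSemisimpleModule_of_adjoint_mem A hA
  by_contra! hcon
  refine htop (eq_top_iff.mpr fun g _ => ?_)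
  have hscal : ∀ φ : End A E, ∃ c : ℂ, ∀ x, φ x = c • x := by
    intro φ
    obtain ⟨c, hc⟩ := hcon (φ.restrictScalars ℂ) fun a ha =>
      LinearMap.ext fun x => φ.map_smul (⟨a, ha⟩ : A) x
    exact ⟨c, fun x => congrArg (· x) hc⟩
  -- If the commutant is scalar, every `g` is linear over it; Jacobson density on a basis then puts
  -- `g` in `A`.
  let G : End (End A E) E :=
    { toFun := g
      map_add' := g.map_add
      map_smul' := fun φ x => by
        obtain ⟨c, hc⟩ := hscal φ
        simp [hc] }
  classical
  let b := finBasis ℂ E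
  obtain ⟨r, hr⟩ := jacobson_density (R := A) G (Finset.univ.image b)
  have : g = r.1 := b.ext fun i => hr (b i) (by simp)
  rw [this]
  exact r.2

end Commutant

/-! ### The necessary condition -/

section Necessity

open Matrix Module Filter Topology
open scoped Matrix.Norms.Frobenius

variable {d : ℕ}

theorem exists_commute_ne_smul_one_of_adjoin_ne_top {s : Set (Matrix (Fin d) (Fin d) ℂ)}
    (hs : ∀ M ∈ s, Mᴴ ∈ s) (htop : Algebra.adjoin ℂ s ≠ ⊤) :
    ∃ F : Matrix (Fin d) (Fin d) ℂ, (∀ M ∈ s, Commute F M) ∧ ∀ c : ℂ, F ≠ c • 1 := by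
  let e : Matrix (Fin d) (Fin d) ℂ ≃ₐ[ℂ] End ℂ (EuclideanSpace ℂ (Fin d)) :=
    toLinAlgEquiv (EuclideanSpace.basisFun (Fin d) ℂ).toBasis
  have he : ∀ M, e M = toEuclideanLin M := fun M => by
    rw [toEuclideanLin_eq_toLin_orthonormal]
    rfl
  have hstar : ∀ M ∈ Algebra.adjoin ℂ s, Mᴴ ∈ Algebra.adjoin ℂ s := by
    intro M hM
    induction hM using Algebra.adjoin_induction with
    | mem M hM => exact Algebra.subset_adjoin (hs M hM)
    | algebraMap r =>
      rw [Algebra.algebraMap_eq_smul_one, conjTranspose_smul, conjTranspose_one]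
      exact Subalgebra.smul_mem _ (one_mem _) _
    | add M M' _ _ h1 h2 => exact conjTranspose_add M M' ▸ add_mem h1 h2
    | mul M M' _ _ h1 h2 => exact conjTranspose_mul M M' ▸ mul_mem h2 h1
  obtain ⟨f, hf, hfc⟩ := exists_commute_ne_smul_one ((Algebra.adjoin ℂ s).map e.toAlgHom)
    (by
      rintro _ ⟨M, hM, rfl⟩
      refine ⟨Mᴴ, hstar M hM, ?_⟩
      change e Mᴴ = LinearMap.adjoint (e M)
      rw [he, he, toEuclideanLin_conjTranspose_eq_adjoint])
    (by
      intro h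
      refine htop (eq_top_iff.mpr fun M _ => ?_)
      obtain ⟨M', hM', heq⟩ : e M ∈ (Algebra.adjoin ℂ s).map e.toAlgHom := h ▸ Algebra.mem_top
      exact e.injective heq ▸ hM')
  refine ⟨e.symm f, fun M hM => ?_, fun c hc => hfc c ?_⟩
  · refine e.injective ?_
    simpa using (hf (e M) ⟨M, Algebra.subset_adjoin hM, rfl⟩).eq
  · rw [e.symm_apply_eq] at hc
    simpa using hc

theorem isState_inv_smul_vecMulVec {x : EuclideanSpace ℂ (Fin d)} (hx : x ≠ 0) :
    IsState (((‖x‖ ^ 2)⁻¹ : ℝ) • vecMulVec x.ofLp (star x.ofLp)) := by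
  have hn : 0 < ‖x‖ := norm_pos_iff.mpr hx
  have htr : (vecMulVec x.ofLp (star x.ofLp)).trace = ((‖x‖ ^ 2 : ℝ) : ℂ) := by
    rw [trace_vecMulVec, ← EuclideanSpace.inner_eq_star_dotProduct, inner_self_eq_norm_sq_to_K]
    simp
  refine ⟨(posSemidef_vecMulVec_self_star x.ofLp).smul (by positivity), ?_⟩
  rw [trace_smul, htr, Complex.real_smul, ← Complex.ofReal_mul, inv_mul_cancel₀ (by positivity),
    Complex.ofReal_one]

/-- If `tr (F ρ) = c` on all states, pure states show that the quadratic form of `F - c` vanishes,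
which over `ℂ` forces `F = c`. -/
theorem exists_state_trace_mul_ne {F : Matrix (Fin d) (Fin d) ℂ} (hF : ∀ c : ℂ, F ≠ c • 1) :
    ∃ ρ σ : Matrix (Fin d) (Fin d) ℂ, IsState ρ ∧ IsState σ ∧ (F * ρ).trace ≠ (F * σ).trace := by
  by_contra! hcon
  obtain ⟨c, hc⟩ : ∃ c, ∀ ρ, IsState ρ → (F * ρ).trace = c := by
    by_cases h : ∃ ρ : Matrix (Fin d) (Fin d) ℂ, IsState ρ
    · obtain ⟨ρ, hρ⟩ := h
      exact ⟨_, fun σ hσ => hcon σ ρ hσ hρ⟩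
    · exact ⟨0, fun ρ hρ => (h ⟨ρ, hρ⟩).elim⟩
  refine hF c (sub_eq_zero.mp ?_)
  rw [← LinearEquiv.map_eq_zero_iff (toEuclideanLin (𝕜 := ℂ)), ← inner_map_self_eq_zero]
  intro x
  by_cases hx : x = 0
  · simp [hx]
  have hst := isState_inv_smul_vecMulVec hx
  have h1 : ((F - c • 1) * (((‖x‖ ^ 2)⁻¹ : ℝ) • vecMulVec x.ofLp (star x.ofLp))).trace = 0 := by
    rw [Matrix.sub_mul, trace_sub, hc _ hst, Matrix.smul_mul, Matrix.one_mul, trace_smul, hst.2]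
    simp
  have hn : ((‖x‖ ^ 2)⁻¹ : ℝ) ≠ 0 := by simpa using hx
  rw [Matrix.mul_smul, trace_smul, smul_eq_zero_iff_right hn, mul_vecMulVec, trace_vecMulVec] at h1
  rw [inner_eq_zero_symm, EuclideanSpace.inner_eq_star_dotProduct, ofLp_toLpLin]
  exact h1

attribute [local instance] frobeniusTopology

theorem adjoin_eq_top_of_hamiltonianIndependentlyContractive {m : ℕ}
    {L : Fin m → Matrix (Fin d) (Fin d) ℂ}
    (h : HamiltonianIndependentlyContractive (dissipator L)) :
    Algebra.adjoin ℂ (Set.range L ∪ Set.range fun j => (L j)ᴴ) = ⊤ := by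
  by_contra htop
  obtain ⟨F, hF, hFc⟩ := exists_commute_ne_smul_one_of_adjoin_ne_top (by
    rintro _ (⟨j, rfl⟩ | ⟨j, rfl⟩)
    · exact Or.inr ⟨j, rfl⟩
    · exact Or.inl ⟨j, (conjTranspose_conjTranspose _).symm⟩) htop
  obtain ⟨ρ, σ, hρ, hσ, hne⟩ := exists_state_trace_mul_ne hFc
  -- Zero Hamiltonian is the test case: a general one need not commute with `F`.
  have hH : IsHamiltonian fun _ : ℝ => (0 : Matrix (Fin d) (Fin d) ℂ) :=
    ⟨fun _ => isHermitian_zero, fun _ _ => locallyIntegrable_zero⟩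
  obtain ⟨K, γ, -, hγ, hdec⟩ := h _ hH
  have hB := locallyIntegrable_generatorCLM hH (dissipator L)
  let φ : Matrix (Fin d) (Fin d) ℂ →L[ℂ] ℂ :=
    (traceLinearMap (Fin d) ℂ ℂ ∘ₗ LinearMap.mulLeft ℂ F).toContinuousLinearMap
  have hφ : ∀ X, φ X = (F * X).trace := fun _ => rfl
  set Y := fun t => evolution (fun _ => hamiltonianPart 0 + dissipator L) t 0 (ρ - σ)
  have hconst : ∀ t, 0 ≤ t → φ (Y t) = φ (ρ - σ) := by
    intro t ht
    have h1 : Y t = (ρ - σ) + ∫ τ in (0 : ℝ)..t, generatorCLM (fun _ => 0) (dissipator L) τ (Y τ) :=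
      timeOrderedExp_eq_add_integral hB (ρ - σ) ht
    have hint : IntervalIntegrable (fun τ => generatorCLM (fun _ => 0) (dissipator L) τ (Y τ))
        volume 0 t := intervalIntegrable_timeOrderedExp hB (ρ - σ) ht
    rw [h1, map_add, ← φ.intervalIntegral_comp_comm hint]
    have h2 : ∀ τ, φ (generatorCLM (fun _ => 0) (dissipator L) τ (Y τ)) = 0 := by
      intro τ
      have : generatorCLM (fun _ => 0) (dissipator L) τ (Y τ) = dissipator L (Y τ) := by
        change hamiltonianPart 0 (Y τ) + dissipator L (Y τ) = _
        simp [hamiltonianPart]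
      rw [this, hφ]
      exact trace_mul_dissipator_eq_zero L (fun j => hF _ (Or.inl ⟨j, rfl⟩))
        (fun j => hF _ (Or.inr ⟨j, rfl⟩)) _
    simp [h2]
  have hle : ∀ t : ℝ, 0 ≤ t →
      ‖φ (ρ - σ)‖ ≤ ‖φ‖ * (K * Real.exp (-(γ * t)) * traceNorm (ρ - σ)) := by
    intro t ht
    rw [← hconst t ht]
    refine φ.le_of_opNorm_le_of_le le_rfl ((frobenius_norm_le_traceNorm _).trans ?_)
    have := hdec ρ σ hρ hσ 0 t le_rfl ht
    rwa [sub_zero, abs_of_nonneg ht, neg_mul] at this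
  have hlim : Tendsto (fun t : ℝ => ‖φ‖ * (K * Real.exp (-(γ * t)) * traceNorm (ρ - σ))) atTop
      (𝓝 0) := by
    have := Real.tendsto_exp_neg_atTop_nhds_zero.comp (tendsto_id.const_mul_atTop hγ)
    simpa using ((this.const_mul K).mul_const (traceNorm (ρ - σ))).const_mul ‖φ‖
  have hzero := ge_of_tendsto hlim (eventually_atTop.mpr ⟨0, hle⟩)
  rw [norm_le_zero_iff, map_sub, sub_eq_zero] at hzero
  exact hne hzero

end Necessity

theorem mainTheorem8 (m : ℕ) (L : Fin m → Matrix (Fin 3) (Fin 3) ℂ) :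
    (Algebra.adjoin ℂ (Set.range L) = ⊤ →
      HamiltonianIndependentlyContractive (dissipator L)) ∧
    (HamiltonianIndependentlyContractive (dissipator L) →
      Algebra.adjoin ℂ (Set.range L ∪ Set.range (fun j => (L j)ᴴ)) = ⊤) :=
  ⟨hamiltonianIndependentlyContractive_of_adjoin_eq_top,
    adjoin_eq_top_of_hamiltonianIndependentlyContractive⟩
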